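/- Let $\mathbb T=\mathbb R/2\pi\mathbb Z$ and, for $f\in L^1(\mathbb T)$, let $\hat f(n)=\frac1{2\pi}\int_{-\pi}^{\pi}f(t)e^{-int}\,dt$ $(n\in\mathbb Z)$. Let $A(\mathbb T)=\{f\in L^1(\mathbb T):\|f\|:=\sum_{n\in\mathbb Z}|\hat f(n)|<\infty\}$ be the Fourier algebra of the circle; its elements are identified with their continuous representatives, and it is a complex Banach algebra under pointwise operations and the norm $\|\cdot\|$. For $f\in A(\mathbb T)$ let $\operatorname{supp} f$ be the closure of $\{x\in\mathbb T: f(x)\neq 0\}$. (1) Let $\phi:A(\mathbb T)\times A(\mathbb T)\to\mathbb C$ be a continuous bilinear map and let $\alpha\ge 0$ be such that $$f,g\in A(\mathbb T),\ \operatorname{supp} f\cap\operatorname{supp} g=\emptyset\ \Longrightarrow\ |\phi(f,g)|\le\alpha\|f\|\,\|g\|.$$ Then $$|\phi(fg,h)-\phi(f,gh)|\le 288\pi(1+\sqrt2)\,\alpha\,\|f\|\,\|g\|\,\|h\|\qquad\text{for all } f,g,h\in A(\mathbb T).$$ (2) Consequently $A(\mathbb T)$ has the strong property (B) with the constant $r=288\pi(1+\sqrt2)$.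 Here a complex Banach algebra $A$ has the strong property (B) with a constant $r>0$ if, for every complex Banach space $X$, every bounded bilinear map $\varphi:A\times A\to X$ and every $\alpha\ge0$ such that $\|\varphi(a,b)\|\le\alpha\|a\|\|b\|$ for all $a,b\in A$ with $ab=0$, one has $\|\varphi(ab,c)-\varphi(a,bc)\|\le r\alpha\|a\|\|b\|\|c\|$ for all $a,b,c\in A$. -/

import Mathlib

universe u v

noncomputable section

open MeasureTheory

instance fact_two_pi_pos : Fact ((0 : ℝ) < 2 * Real.pi) := ⟨Real.two_pi_pos⟩

/-- The circle `ℝ / 2πℤ`. -/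
abbrev Torus : Type := AddCircle (2 * Real.pi)

namespace FourierAlgebra

/-- The `n`-th Fourier coefficient as a continuous linear functional on `C(𝕋)`. -/
def coeffCLM (n : ℤ) : C(Torus, ℂ) →L[ℂ] ℂ :=
  LinearMap.mkContinuous
    { toFun := fun f => fourierCoeff (f : Torus → ℂ) n
      map_add' := fun f g => by
        have hf : Integrable (f : Torus → ℂ) AddCircle.haarAddCircle :=
          f.continuous.integrable_of_hasCompactSupport (HasCompactSupport.of_compactSpace _)
        have hg : Integrable (g : Torus → ℂ) AddCircle.haarAddCircle :=
          g.continuous.integrable_of_hasCompactSupport (HasCompactSupport.of_compactSpace _)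
        rw [ContinuousMap.coe_add, fourierCoeff.add hf hg, Pi.add_apply]
      map_smul' := fun c f => by
        rw [ContinuousMap.coe_smul, fourierCoeff.const_smul, RingHom.id_apply] }
    1
    (fun f => by
      change ‖∫ t : Torus, fourier (-n) t • f t ∂AddCircle.haarAddCircle‖ ≤ 1 * ‖f‖
      have := norm_integral_le_of_norm_le_const (μ := (AddCircle.haarAddCircle : Measure Torus))
        (f := fun t : Torus => fourier (-n) t • f t) (C := ‖f‖)
        (Filter.Eventually.of_forall fun t => by
          rw [norm_smul, fourier_apply, Circle.norm_coe, one_mul]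
          exact f.norm_coe_le_norm t)
      simpa using this)

theorem coeffCLM_apply (n : ℤ) (f : C(Torus, ℂ)) :
    coeffCLM n f = fourierCoeff (f : Torus → ℂ) n := rfl

/-- Fourier coefficients of an absolutely convergent sum of characters. -/
theorem hasSum_coeff {ι : Type*} {c : ι → ℂ} {m : ι → ℤ} {F : C(Torus, ℂ)}
    (hF : HasSum (fun i => c i • (fourier (m i) : C(Torus, ℂ))) F) (n : ℤ) :
    HasSum (fun i => if m i = n then c i else 0) (fourierCoeff (F : Torus → ℂ) n) := by
  have h := (coeffCLM n).hasSum hF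
  rw [coeffCLM_apply] at h
  refine h.congr_fun ?_
  intro i
  simp only [map_smul, coeffCLM_apply, fourierCoeff_fourier, smul_eq_mul, Pi.single_apply, eq_comm]
  split_ifs <;> simp

theorem summable_fiber {ι : Type*} {c : ι → ℂ} (m : ι → ℤ) (hc : Summable fun i => ‖c i‖) :
    Summable (fun p : ι × ℤ => if m p.1 = p.2 then ‖c p.1‖ else 0) := by
  rw [summable_prod_of_nonneg (fun p => by dsimp; split_ifs <;> positivity)]
  refine ⟨fun i => (hasSum_ite_eq (m i) ‖c i‖).summable.congr fun n => by simp [eq_comm], ?_⟩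
  refine hc.congr fun i => ?_
  simp [eq_comm]

theorem coeff_sum_bound {ι : Type*} {c : ι → ℂ} {m : ι → ℤ} {F : C(Torus, ℂ)}
    (hc : Summable fun i => ‖c i‖)
    (hF : HasSum (fun i => c i • (fourier (m i) : C(Torus, ℂ))) F) :
    Summable (fun n => ‖fourierCoeff (F : Torus → ℂ) n‖) ∧
      ∑' n, ‖fourierCoeff (F : Torus → ℂ) n‖ ≤ ∑' i, ‖c i‖ := by
  have hs := summable_fiber m hc
  have hs' : Summable (fun p : ℤ × ι => if m p.2 = p.1 then ‖c p.2‖ else 0) :=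
    hs.prod_symm
  have hs2 := hs'.prod
  have hle : ∀ n, ‖fourierCoeff (F : Torus → ℂ) n‖ ≤ ∑' i, if m i = n then ‖c i‖ else 0 := by
    intro n
    rw [← (hasSum_coeff hF n).tsum_eq]
    have hn : ∀ i, ‖(if m i = n then c i else 0 : ℂ)‖ = if m i = n then ‖c i‖ else 0 := by
      intro i; split_ifs <;> simp
    have := norm_tsum_le_tsum_norm (f := fun i => (if m i = n then c i else 0 : ℂ))
      (by simp only [hn]; exact hs'.prod_factor n)
    simpa only [hn] using this
  have hsum := Summable.of_nonneg_of_le (fun n => norm_nonneg _) hle hs2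
  refine ⟨hsum, (hsum.tsum_le_tsum hle hs2).trans (le_of_eq ?_)⟩
  have := Summable.tsum_comm (f := fun (n : ℤ) (i : ι) => if m i = n then ‖c i‖ else 0) hs'
  rw [← this]
  refine tsum_congr fun i => ?_
  simp [eq_comm]

theorem mul_bound {f g : C(Torus, ℂ)}
    (hf : Summable fun n => ‖fourierCoeff (f : Torus → ℂ) n‖)
    (hg : Summable fun n => ‖fourierCoeff (g : Torus → ℂ) n‖) :
    Summable (fun n => ‖fourierCoeff ((f * g : C(Torus, ℂ)) : Torus → ℂ) n‖) ∧
      ∑' n, ‖fourierCoeff ((f * g : C(Torus, ℂ)) : Torus → ℂ) n‖ ≤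
        (∑' n, ‖fourierCoeff (f : Torus → ℂ) n‖) * ∑' n, ‖fourierCoeff (g : Torus → ℂ) n‖ := by
  have hF := hasSum_fourier_series_of_summable hf.of_norm
  have hG := hasSum_fourier_series_of_summable hg.of_norm
  have hc : Summable fun p : ℤ × ℤ =>
      ‖fourierCoeff (f : Torus → ℂ) p.1 * fourierCoeff (g : Torus → ℂ) p.2‖ :=
    Summable.mul_norm hf hg
  have hterm : ∀ p : ℤ × ℤ,
      (fourierCoeff (f : Torus → ℂ) p.1 * fourierCoeff (g : Torus → ℂ) p.2) •
        (fourier (p.1 + p.2) : C(Torus, ℂ)) =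
      (fourierCoeff (f : Torus → ℂ) p.1 • (fourier p.1 : C(Torus, ℂ))) *
        (fourierCoeff (g : Torus → ℂ) p.2 • (fourier p.2 : C(Torus, ℂ))) := by
    intro p
    have : (fourier (p.1 + p.2) : C(Torus, ℂ)) = fourier p.1 * fourier p.2 := by
      ext x
      rw [ContinuousMap.mul_apply, fourier_add]
    rw [this, smul_mul_smul_comm]
  have hsm : Summable fun p : ℤ × ℤ =>
      (fourierCoeff (f : Torus → ℂ) p.1 • (fourier p.1 : C(Torus, ℂ))) *
        (fourierCoeff (g : Torus → ℂ) p.2 • (fourier p.2 : C(Torus, ℂ))) := by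
    simp only [← hterm]
    refine Summable.of_norm ?_
    simpa only [norm_smul, fourier_norm, mul_one] using hc
  have hFG := hF.mul hG hsm
  have key := coeff_sum_bound (m := fun p : ℤ × ℤ => p.1 + p.2) hc (F := f * g)
    (by simpa only [hterm] using hFG)
  refine ⟨key.1, key.2.trans (le_of_eq ?_)⟩
  simp only [norm_mul] at hc ⊢
  exact (hf.tsum_mul_tsum hg hc).symm

/-- The continuous functions on the circle with absolutely summable Fourier coefficients, as a
subalgebra of `C(𝕋)` (pointwise operations). -/
def carrierSubalgebra : Subalgebra ℂ C(Torus, ℂ) where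
  carrier := {f | Summable fun n : ℤ => ‖fourierCoeff (f : Torus → ℂ) n‖}
  mul_mem' hf hg := (mul_bound hf hg).1
  add_mem' {f g} hf hg := by
    refine Summable.of_nonneg_of_le (fun n => norm_nonneg _) (fun n => ?_) (hf.add hg)
    rw [← coeffCLM_apply, map_add]
    exact norm_add_le _ _
  algebraMap_mem' r := by
    have h : HasSum (fun _ : Unit => r • (fourier 0 : C(Torus, ℂ)))
        (algebraMap ℂ C(Torus, ℂ) r) := by
      convert hasSum_unique (fun _ : Unit => r • (fourier 0 : C(Torus, ℂ))) using 1
      ext x; simp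
    exact (coeff_sum_bound (c := fun _ : Unit => r) (m := fun _ => 0) (Summable.of_finite) h).1

end FourierAlgebra

open FourierAlgebra

/-- The Fourier algebra `A(𝕋)`: functions on the circle whose Fourier coefficients are absolutely
summable, each represented by its continuous representative, with pointwise operations. It is a
separate type so that it does not inherit the supremum norm. -/
def FourierAlgebra : Type := carrierSubalgebra

namespace FourierAlgebra

instance : CommRing FourierAlgebra := inferInstanceAs (CommRing carrierSubalgebra)

instance : Algebra ℂ FourierAlgebra := inferInstanceAs (Algebra ℂ carrierSubalgebra)

/-- The inclusion `A(𝕋) → C(𝕋)`. -/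
def toC : FourierAlgebra →ₐ[ℂ] C(Torus, ℂ) := carrierSubalgebra.val

instance : CoeFun FourierAlgebra (fun _ => Torus → ℂ) := ⟨fun f => toC f⟩

theorem toC_injective : Function.Injective toC := Subtype.val_injective

theorem summable_coeff (f : FourierAlgebra) :
    Summable fun n : ℤ => ‖fourierCoeff (f : Torus → ℂ) n‖ := f.2

/-- `‖f‖ = ∑ₙ |f̂(n)|`. -/
instance : Norm FourierAlgebra := ⟨fun f => ∑' n : ℤ, ‖fourierCoeff (f : Torus → ℂ) n‖⟩

theorem norm_def (f : FourierAlgebra) :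
    ‖f‖ = ∑' n : ℤ, ‖fourierCoeff (f : Torus → ℂ) n‖ := rfl

theorem norm_eq (f : FourierAlgebra) : ‖f‖ = ∑' n : ℤ, ‖coeffCLM n (toC f)‖ := rfl

instance : NormedAddCommGroup FourierAlgebra :=
  AddGroupNorm.toNormedAddCommGroup
    { toFun := fun f => ‖f‖
      map_zero' := by simp [norm_eq]
      add_le' := fun f g => by
        have hf : Summable fun n => ‖coeffCLM n (toC f)‖ := summable_coeff f
        have hg : Summable fun n => ‖coeffCLM n (toC g)‖ := summable_coeff g
        have hfg : Summable fun n => ‖coeffCLM n (toC (f + g))‖ := summable_coeff (f + g)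
        simp only [norm_eq]
        rw [← hf.tsum_add hg]
        refine hfg.tsum_le_tsum (fun n => ?_) (hf.add hg)
        rw [map_add, map_add]
        exact norm_add_le _ _
      neg' := fun f => by simp [norm_eq]
      eq_zero_of_map_eq_zero' := fun f h => by
        have h0 : ∀ n, fourierCoeff (f : Torus → ℂ) n = 0 := by
          intro n
          have := (hasSum_zero_iff_of_nonneg (fun n => norm_nonneg _)).1
            ((show ∑' n : ℤ, ‖fourierCoeff (f : Torus → ℂ) n‖ = 0 from h) ▸
              (summable_coeff f).hasSum)
          simpa using congrFun this n
        apply toC_injective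
        have hs := hasSum_fourier_series_of_summable (summable_coeff f).of_norm
        simp only [h0, zero_smul] at hs
        rw [map_zero]
        exact hs.unique hasSum_zero }

instance : NormedCommRing FourierAlgebra :=
  { (inferInstance : NormedAddCommGroup FourierAlgebra),
    (inferInstance : CommRing FourierAlgebra) with
    norm_mul_le := fun f g => (mul_bound (summable_coeff f) (summable_coeff g)).2 }

instance : NormedAlgebra ℂ FourierAlgebra :=
  { (inferInstance : Algebra ℂ FourierAlgebra) with
    norm_smul_le := fun c f => by
      simp only [norm_eq, map_smul, norm_smul]
      rw [tsum_mul_left] }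

/-- An absolutely summable sequence is the sequence of Fourier coefficients of some element. -/
theorem exists_coeff_eq {a : ℤ → ℂ} (ha : Summable fun n => ‖a n‖) :
    ∃ f : FourierAlgebra, ∀ n, fourierCoeff (f : Torus → ℂ) n = a n := by
  have hs : Summable fun n => a n • (fourier n : C(Torus, ℂ)) :=
    Summable.of_norm (by simpa only [norm_smul, fourier_norm, mul_one] using ha)
  refine ⟨⟨∑' n, a n • (fourier n : C(Torus, ℂ)),
    (coeff_sum_bound (m := fun n => n) ha hs.hasSum).1⟩, fun n => ?_⟩
  refine (hasSum_coeff (m := fun n => n) hs.hasSum n).unique ?_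
  convert hasSum_ite_eq n (a n) using 2 with k
  split_ifs with h
  · rw [h]
  · rfl

/-- The Fourier transform as an isometry onto `ℓ¹(ℤ)`. -/
def toL1 (f : FourierAlgebra) : lp (fun _ : ℤ => ℂ) 1 :=
  ⟨fourierCoeff (f : Torus → ℂ), memℓp_gen (by simpa using summable_coeff f)⟩

theorem isometry_toL1 : Isometry toL1 := by
  refine Isometry.of_dist_eq fun f g => ?_
  rw [dist_eq_norm, dist_eq_norm, lp.norm_eq_tsum_rpow (by simp), norm_eq]
  simp only [ENNReal.toReal_one, Real.rpow_one, div_one, map_sub]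
  rfl

theorem surjective_toL1 : Function.Surjective toL1 := by
  intro a
  obtain ⟨f, hf⟩ := exists_coeff_eq (a := a) (by simpa using a.2.summable (by simp))
  exact ⟨f, Subtype.ext (funext hf)⟩

instance : CompleteSpace FourierAlgebra := by
  rw [completeSpace_iff_isComplete_range isometry_toL1.isUniformInducing,
    surjective_toL1.range_eq]
  exact completeSpace_iff_isComplete_univ.1 inferInstance

/-- The support of `f ∈ A(𝕋)`: the closure of `{x | f x ≠ 0}`. -/
def supp (f : FourierAlgebra) : Set Torus := tsupport (f : Torus → ℂ)

/-- Restricting to continuous functions loses nothing: every `f ∈ L¹(𝕋)` with absolutely summable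
Fourier coefficients agrees almost everywhere with an element of `A(𝕋)`. -/
theorem exists_ae_eq {f : Torus → ℂ} (hf : Integrable f AddCircle.haarAddCircle)
    (hs : Summable fun n : ℤ => ‖fourierCoeff f n‖) :
    ∃ g : FourierAlgebra, f =ᵐ[AddCircle.haarAddCircle] (g : Torus → ℂ) := by
  obtain ⟨g, hg⟩ := exists_coeff_eq hs
  refine ⟨g, ?_⟩
  have hgi : Integrable (g : Torus → ℂ) AddCircle.haarAddCircle :=
    (toC g).continuous.integrable_of_hasCompactSupport (HasCompactSupport.of_compactSpace _)
  set h : Torus → ℂ := fun t => f t - g t with hh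
  have hi : Integrable h AddCircle.haarAddCircle := hf.sub hgi
  -- `h` annihilates every character
  have h0 : ∀ n : ℤ, ∫ t, fourier n t * h t ∂AddCircle.haarAddCircle = 0 := by
    intro n
    have e : ∫ t, (fourier n t • f t - fourier n t • g t) ∂AddCircle.haarAddCircle = 0 := by
      rw [integral_sub (hf.fourier_smul n) (hgi.fourier_smul n), sub_eq_zero]
      have := hg (-n)
      simp only [fourierCoeff, neg_neg] at this
      exact this.symm
    simpa only [hh, smul_eq_mul, mul_sub] using e
  -- hence every continuous function
  have hmul : ∀ u : C(Torus, ℂ), Integrable (fun t => u t * h t) AddCircle.haarAddCircle :=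
    fun u => hi.bdd_mul u.continuous.aestronglyMeasurable
      (Filter.Eventually.of_forall fun t => u.norm_coe_le_norm t)
  let L : C(Torus, ℂ) →L[ℂ] ℂ := LinearMap.mkContinuous
    { toFun := fun u => ∫ t, u t * h t ∂AddCircle.haarAddCircle
      map_add' := fun u v => by
        rw [← integral_add (hmul u) (hmul v)]
        simp only [ContinuousMap.add_apply, add_mul]
      map_smul' := fun c u => by
        simp only [ContinuousMap.smul_apply, smul_eq_mul, mul_assoc, integral_const_mul,
          RingHom.id_apply] }
    (∫ t, ‖h t‖ ∂AddCircle.haarAddCircle)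
    (fun u => by
      refine (norm_integral_le_of_norm_le (hi.norm.mul_const ‖u‖)
        (Filter.Eventually.of_forall fun t => ?_)).trans_eq (integral_mul_const _ _)
      rw [norm_mul, mul_comm]
      exact mul_le_mul_of_nonneg_left (u.norm_coe_le_norm t) (norm_nonneg _))
  have hL : ∀ u, L u = 0 := by
    have hle : (Submodule.span ℂ (Set.range (@fourier (2 * Real.pi)))).topologicalClosure
        ≤ LinearMap.ker L.toLinearMap := by
      refine Submodule.topologicalClosure_minimal _ ?_ L.isClosed_ker
      rw [Submodule.span_le]
      rintro _ ⟨n, rfl⟩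
      exact h0 n
    rw [span_fourier_closure_eq_top] at hle
    exact fun u => hle Submodule.mem_top
  have hzero : h =ᵐ[AddCircle.haarAddCircle] 0 := by
    refine ae_eq_zero_of_forall_setIntegral_isClosed_eq_zero hi fun K hK => ?_
    obtain ⟨δ, -, hδ, hlim⟩ := exists_seq_strictAnti_tendsto (0 : ℝ)
    have hT := thickenedIndicator_tendsto_indicator_closure hδ hlim K
    rw [hK.closure_eq, tendsto_pi_nhds] at hT
    rw [← integral_indicator hK.measurableSet]
    refine tendsto_nhds_unique (tendsto_integral_of_dominated_convergence
      (F := fun n t => (((thickenedIndicator (hδ n) K t : NNReal) : ℝ) : ℂ) * h t)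
      (fun t => ‖h t‖) (fun n => ?_) hi.norm (fun n => ?_) ?_) ?_
    · exact (Complex.continuous_ofReal.comp (NNReal.continuous_coe.comp
        (thickenedIndicator (hδ n) K).continuous)).aestronglyMeasurable.mul
        hi.aestronglyMeasurable
    · refine Filter.Eventually.of_forall fun t => ?_
      rw [norm_mul, Complex.norm_real, Real.norm_of_nonneg (NNReal.coe_nonneg _)]
      exact mul_le_of_le_one_left (norm_nonneg _)
        (by exact_mod_cast thickenedIndicator_le_one (hδ n) K t)
    · refine Filter.Eventually.of_forall fun t => ?_
      have h1 := ((Complex.continuous_ofReal.comp NNReal.continuous_coe).tendsto _).comp (hT t)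
      have h2 := h1.mul_const (h t)
      have e : K.indicator h t = (Complex.ofReal ∘ NNReal.toReal)
          (K.indicator (fun _ => (1 : NNReal)) t) * h t := by
        by_cases ht : t ∈ K <;> simp [ht]
      rw [e]
      exact h2
    · have : ∀ n, ∫ t, (((thickenedIndicator (hδ n) K t : NNReal) : ℝ) : ℂ) * h t
          ∂AddCircle.haarAddCircle = 0 := fun n =>
        hL ⟨fun t => (((thickenedIndicator (hδ n) K t : NNReal) : ℝ) : ℂ),
          Complex.continuous_ofReal.comp (NNReal.continuous_coe.comp
            (thickenedIndicator (hδ n) K).continuous)⟩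
      simp only [this]
      exact tendsto_const_nhds
  filter_upwards [hzero] with t ht
  exact sub_eq_zero.1 ht

end FourierAlgebra

/-- A (not necessarily unital) complex Banach algebra `A` has the strong property (B) with constant
`r > 0`: for every Banach space `X` and bounded bilinear `φ : A × A → X` with
`‖φ(a, b)‖ ≤ α‖a‖‖b‖` whenever `ab = 0`, one has
`‖φ(ab, c) - φ(a, bc)‖ ≤ rα‖a‖‖b‖‖c‖` for all `a, b, c`. -/
def HasStrongPropertyB (A : Type v) [NonUnitalNormedRing A] [NormedSpace ℂ A]
    [IsScalarTower ℂ A A] [SMulCommClass ℂ A A] [CompleteSpace A] (r : ℝ) : Prop :=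
  0 < r ∧
  ∀ (X : Type u) [NormedAddCommGroup X] [NormedSpace ℂ X] [CompleteSpace X]
    (φ : A →L[ℂ] A →L[ℂ] X) (α : ℝ), 0 ≤ α →
    (∀ a b : A, a * b = 0 → ‖φ a b‖ ≤ α * ‖a‖ * ‖b‖) →
    ∀ a b c : A, ‖φ (a * b) c - φ a (b * c)‖ ≤ r * α * ‖a‖ * ‖b‖ * ‖c‖

end

/-!
Write `eₙ` for the characters and let `ψ` be a bounded bilinear map on `A(𝕋)` with values in a
Banach space. The difference to be bounded is, for characters, a value of the linear map
`w ↦ ∑ₙ ŵ(n) ψ(eₙ, e₋ₙ)` at `w = e₁ - 1`, with `ψ` twisted by characters and dilated. This map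
pairs `ψ` with the function `w(x - y)` of two variables; when `w` vanishes on the arc
`|x| ≤ π / 2`, a partition of unity made of sixteen hat functions cuts `w(x - y)` into pieces on
which the supports of the two arguments of `ψ` are disjoint, so that `ψ` is bounded by `α` there.

The function `T(x) = π|x| / 4` is homogeneous near `0`: `T - T(2 ·) / 2` vanishes on that arc.
Since the seminorm of `w` under all twists and dilations of the pairing does not increase when `w`
is dilated, it is at most twice as large at `T` as at `T - T(2 ·) / 2`. In the expansion
`T(x) = ∑ₖ (1 - cos (2k + 1)x) / (2k + 1)²` the coefficients with `k ≥ 1` add up to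
`π² / 8 - 1 < 1`, so the first term absorbs the others, and the seminorm of `1 - cos x` is
controlled too. Finally `e₁ - 1 = (e₂ - 1) / 2 + e₁ (1 - cos x)`, where `e₂ - 1` is a dilate of
`e₁ - 1`.
-/

noncomputable section

namespace FourierAlgebra

/-! ### Characters and Fourier series -/

theorem ext {f g : FourierAlgebra} (h : ∀ x, f x = g x) : f = g :=
  toC_injective (ContinuousMap.ext h)

theorem one_apply (x : Torus) : (1 : FourierAlgebra) x = 1 := by
  rw [map_one, ContinuousMap.one_apply]

theorem mul_apply (f g : FourierAlgebra) (x : Torus) : (f * g) x = f x * g x := by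
  rw [map_mul, ContinuousMap.mul_apply]

theorem norm_toC_le (f : FourierAlgebra) : ‖toC f‖ ≤ ‖f‖ := by
  refine (hasSum_fourier_series_of_summable (summable_coeff f).of_norm).norm_le_of_bounded
    (summable_coeff f).hasSum fun n => ?_
  rw [norm_smul, fourier_norm, mul_one]

/-- The inclusion `A(𝕋) → C(𝕋)` as a continuous linear map. -/
def toCL : FourierAlgebra →L[ℂ] C(Torus, ℂ) :=
  toC.toLinearMap.mkContinuous 1 fun f => by simpa using norm_toC_le f

/-- Point evaluation on `A(𝕋)`. -/
def evalCL (x : Torus) : FourierAlgebra →L[ℂ] ℂ :=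
  (ContinuousMap.evalCLM ℂ x).comp toCL

theorem evalCL_apply (x : Torus) (f : FourierAlgebra) : evalCL x f = f x := rfl

/-- The `n`-th Fourier coefficient as a continuous linear functional on `A(𝕋)`. -/
def coeff (n : ℤ) : FourierAlgebra →L[ℂ] ℂ := (coeffCLM n).comp toCL

theorem coeff_apply (n : ℤ) (f : FourierAlgebra) : coeff n f = fourierCoeff f n := rfl

theorem norm_coeff_le (n : ℤ) (f : FourierAlgebra) : ‖coeff n f‖ ≤ ‖f‖ :=
  (summable_coeff f).le_tsum n fun _ _ => norm_nonneg _

theorem coeffCLM_fourier (k n : ℤ) :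
    coeffCLM k (fourier n : C(Torus, ℂ)) = if k = n then 1 else 0 := by
  rw [coeffCLM_apply, fourierCoeff_fourier, Pi.single_apply]

/-- The character `x ↦ e^{inx}` as an element of `A(𝕋)`. -/
def chr (n : ℤ) : FourierAlgebra :=
  ⟨fourier n, by
    change Summable fun k : ℤ => ‖coeffCLM k (fourier n : C(Torus, ℂ))‖
    simp only [coeffCLM_fourier]
    refine (hasSum_ite_eq n (1 : ℝ)).summable.congr fun k => ?_
    split_ifs <;> simp⟩

theorem chr_apply (n : ℤ) (x : Torus) : chr n x = fourier n x := rfl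

theorem coeff_chr (k n : ℤ) : coeff k (chr n) = if k = n then 1 else 0 := coeffCLM_fourier k n

theorem norm_chr (n : ℤ) : ‖chr n‖ = 1 := by
  refine (tsum_congr fun k => ?_).trans (hasSum_ite_eq n (1 : ℝ)).tsum_eq
  rw [← coeff_apply, coeff_chr]
  split_ifs <;> simp

theorem chr_add (m n : ℤ) : chr (m + n) = chr m * chr n :=
  ext fun x => by rw [mul_apply, chr_apply, chr_apply, chr_apply, fourier_add]

theorem chr_zero : chr 0 = 1 :=
  ext fun x => by rw [chr_apply, fourier_zero, one_apply]

theorem norm_one : ‖(1 : FourierAlgebra)‖ = 1 := by rw [← chr_zero, norm_chr]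

theorem norm_chr_mul_le (n : ℤ) (f : FourierAlgebra) : ‖chr n * f‖ ≤ ‖f‖ := by
  simpa only [norm_chr, one_mul] using norm_mul_le (chr n) f

theorem coeff_mul_chr (p n : ℤ) (f : FourierAlgebra) :
    coeff p (f * chr n) = coeff (p - n) f := by
  rw [coeff_apply, coeff_apply]
  refine MeasureTheory.integral_congr_ae (Filter.Eventually.of_forall fun x => ?_)
  change fourier (-p) x • (f * chr n) x = fourier (-(p - n)) x • f x
  rw [mul_apply, chr_apply, neg_sub, sub_eq_neg_add, fourier_add, smul_eq_mul, smul_eq_mul]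
  ring

section Lift

variable {E : Type*} [NormedAddCommGroup E] [NormedSpace ℂ E] {a : ℤ → E} {B : ℝ}

theorem norm_coeff_smul_le (ha : ∀ n, ‖a n‖ ≤ B) (f : FourierAlgebra) (n : ℤ) :
    ‖coeff n f • a n‖ ≤ ‖coeff n f‖ * B := by
  rw [norm_smul]
  gcongr
  exact ha n

variable [CompleteSpace E]

theorem summable_coeff_smul (ha : ∀ n, ‖a n‖ ≤ B) (f : FourierAlgebra) :
    Summable fun n => coeff n f • a n :=
  .of_norm_bounded ((summable_coeff f).mul_right B) (norm_coeff_smul_le ha f)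

/-- The continuous linear map on `A(𝕋)` sending the `n`-th character to `a n`, for a bounded
family `a`. -/
def lift (a : ℤ → E) (ha : ∀ n, ‖a n‖ ≤ B) : FourierAlgebra →L[ℂ] E :=
  LinearMap.mkContinuous
    { toFun := fun f => ∑' n, coeff n f • a n
      map_add' := fun f g => by
        simp only [map_add, add_smul]
        exact (summable_coeff_smul ha f).tsum_add (summable_coeff_smul ha g)
      map_smul' := fun c f => by
        simp only [map_smul, smul_eq_mul, mul_smul, RingHom.id_apply]
        exact (summable_coeff_smul ha f).tsum_const_smul c }
    B fun f => by
      rw [mul_comm]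
      exact tsum_of_norm_bounded ((summable_coeff f).hasSum.mul_right B) (norm_coeff_smul_le ha f)

theorem hasSum_lift (ha : ∀ n, ‖a n‖ ≤ B) (f : FourierAlgebra) :
    HasSum (fun n => coeff n f • a n) (lift a ha f) :=
  (summable_coeff_smul ha f).hasSum

theorem lift_chr (ha : ∀ n, ‖a n‖ ≤ B) (n : ℤ) : lift a ha (chr n) = a n := by
  refine (hasSum_lift ha (chr n)).unique ((hasSum_ite_eq n (a n)).congr_fun fun k => ?_)
  rw [coeff_chr, ite_smul, one_smul, zero_smul]
  split_ifs with h <;> simp only [h]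

end Lift

theorem hasSum_chr (f : FourierAlgebra) : HasSum (fun n => coeff n f • chr n) f := by
  have hlift := hasSum_lift (fun n => (norm_chr n).le) f
  have lift_eq : lift chr (fun n => (norm_chr n).le) f = f :=
    toC_injective <| (toCL.hasSum hlift).unique <| by
      simp only [map_smul]
      exact hasSum_fourier_series_of_summable (summable_coeff f).of_norm
  rwa [lift_eq] at hlift

theorem hasSum_apply (f : FourierAlgebra) (x : Torus) :
    HasSum (fun n => coeff n f * fourier n x) (f x) := by
  simpa only [map_smul, evalCL_apply, chr_apply, smul_eq_mul] using
    (evalCL x).hasSum (hasSum_chr f)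

section Ext

variable {E : Type*} [NormedAddCommGroup E] [NormedSpace ℂ E]

theorem ext_chr {S T : FourierAlgebra →L[ℂ] E} (h : ∀ n, S (chr n) = T (chr n)) : S = T := by
  ext f
  refine (S.hasSum (hasSum_chr f)).unique ((T.hasSum (hasSum_chr f)).congr_fun fun n => ?_)
  rw [map_smul, map_smul, h]

theorem norm_le_of_norm_chr_le (T : FourierAlgebra →L[ℂ] E) {C : ℝ}
    (hT : ∀ n, ‖T (chr n)‖ ≤ C) (f : FourierAlgebra) : ‖T f‖ ≤ C * ‖f‖ := by
  rw [mul_comm]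
  refine (T.hasSum (hasSum_chr f)).norm_le_of_bounded ((summable_coeff f).hasSum.mul_right C)
    fun n => ?_
  rw [map_smul]
  exact norm_coeff_smul_le hT f n

end Ext

/-! ### Dilations, translations and supports -/

/-- The dilation `f ↦ f(N ·)`. -/
def dilate (N : ℤ) : FourierAlgebra →L[ℂ] FourierAlgebra :=
  lift (fun n => chr (N * n)) fun _ => (norm_chr _).le

theorem dilate_chr (N n : ℤ) : dilate N (chr n) = chr (N * n) := lift_chr _ n

theorem dilate_one (N : ℤ) : dilate N 1 = 1 := by
  rw [← chr_zero, dilate_chr, mul_zero]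

theorem norm_dilate_le (N : ℤ) (f : FourierAlgebra) : ‖dilate N f‖ ≤ ‖f‖ := by
  simpa only [one_mul] using
    norm_le_of_norm_chr_le (dilate N) (C := 1) (fun n => by rw [dilate_chr, norm_chr]) f

theorem dilate_apply (N : ℤ) (f : FourierAlgebra) (x : Torus) : dilate N f x = f (N • x) := by
  refine ((evalCL x).hasSum (hasSum_lift _ f)).unique
    ((hasSum_apply f (N • x)).congr_fun fun n => ?_)
  simp only [map_smul, evalCL_apply, chr_apply, smul_eq_mul, fourier_apply, smul_smul, mul_comm]

theorem norm_fourier_smul_chr (y : Torus) (m n : ℤ) : ‖(fourier m y : ℂ) • chr n‖ = 1 := by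
  rw [norm_smul, norm_chr, mul_one, fourier_apply, Circle.norm_coe]

/-- The translation `f ↦ f(· - y)`. -/
def translate (y : Torus) : FourierAlgebra →L[ℂ] FourierAlgebra :=
  lift (fun n => (fourier (-n) y : ℂ) • chr n) fun n => (norm_fourier_smul_chr y (-n) n).le

theorem hasSum_translate (y : Torus) (f : FourierAlgebra) :
    HasSum (fun n => coeff n f • (fourier (-n) y : ℂ) • chr n) (translate y f) :=
  hasSum_lift _ f

theorem norm_translate_le (y : Torus) (f : FourierAlgebra) : ‖translate y f‖ ≤ ‖f‖ := by
  simpa only [one_mul] using norm_le_of_norm_chr_le (translate y) (C := 1)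
    (fun n => by rw [translate, lift_chr]; exact (norm_fourier_smul_chr y (-n) n).le) f

theorem translate_apply (y : Torus) (f : FourierAlgebra) (x : Torus) :
    translate y f x = f (x - y) := by
  refine ((evalCL x).hasSum (hasSum_translate y f)).unique
    ((hasSum_apply f (x - y)).congr_fun fun n => ?_)
  have fourier_sub : (fourier n (x - y) : ℂ) = fourier (-n) y * fourier n x := by
    rw [fourier_apply, fourier_apply, fourier_apply, ← Circle.coe_mul, ← AddCircle.toCircle_add,
      smul_sub, neg_smul, neg_add_eq_sub]
  rw [map_smul, map_smul, evalCL_apply, chr_apply, fourier_sub, smul_eq_mul, smul_eq_mul]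

theorem supp_mul_subset_right (f g : FourierAlgebra) : (f * g).supp ⊆ g.supp := by
  rw [supp, map_mul, ContinuousMap.coe_mul]
  exact tsupport_mul_subset_right

theorem supp_dilate_subset (N : ℤ) (f : FourierAlgebra) :
    (dilate N f).supp ⊆ (fun x => N • x) ⁻¹' f.supp := by
  rw [supp, show (dilate N f : Torus → ℂ) = f ∘ fun x => N • x from funext (dilate_apply N f)]
  exact tsupport_comp_subset_preimage _ (continuous_zsmul N)

theorem mul_eq_zero_of_supp_inter_eq_empty {f g : FourierAlgebra} (h : f.supp ∩ g.supp = ∅) :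
    f * g = 0 := by
  refine ext fun x => ?_
  rw [mul_apply, map_zero, ContinuousMap.zero_apply, mul_eq_zero]
  by_contra! hx
  exact (h ▸ Set.notMem_empty x) ⟨subset_tsupport _ hx.1, subset_tsupport _ hx.2⟩

/-! ### The antidiagonal map of a bilinear map -/

section Bilinear

variable {E : Type*} [NormedAddCommGroup E] [NormedSpace ℂ E]
  {ψ : FourierAlgebra →L[ℂ] FourierAlgebra →L[ℂ] E} {α : ℝ}

/-- `ψ` is bounded by `α` on pairs of functions with disjoint supports. -/
def DisjointBound (α : ℝ) (ψ : FourierAlgebra →L[ℂ] FourierAlgebra →L[ℂ] E) : Prop :=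
  ∀ f g : FourierAlgebra, f.supp ∩ g.supp = ∅ → ‖ψ f g‖ ≤ α * ‖f‖ * ‖g‖

/-- The bilinear map `(f, g) ↦ ψ(uf, vg)`. -/
def mulForm (ψ : FourierAlgebra →L[ℂ] FourierAlgebra →L[ℂ] E) (u v : FourierAlgebra) :
    FourierAlgebra →L[ℂ] FourierAlgebra →L[ℂ] E :=
  ψ.bilinearComp (ContinuousLinearMap.mul ℂ FourierAlgebra u)
    (ContinuousLinearMap.mul ℂ FourierAlgebra v)

theorem mulForm_apply (u v f g : FourierAlgebra) : mulForm ψ u v f g = ψ (u * f) (v * g) := rfl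

theorem mulForm_one_one : mulForm ψ 1 1 = ψ := by
  ext f g
  rw [mulForm_apply, one_mul, one_mul]

theorem DisjointBound.mulForm (hα : 0 ≤ α) (hψ : DisjointBound α ψ) (u v : FourierAlgebra) :
    DisjointBound (α * ‖u‖ * ‖v‖) (mulForm ψ u v) := fun f g hfg => by
  have supp_inter : (u * f).supp ∩ (v * g).supp = ∅ := Set.subset_empty_iff.1 <|
    hfg ▸ Set.inter_subset_inter (supp_mul_subset_right u f) (supp_mul_subset_right v g)
  calc ‖ψ (u * f) (v * g)‖ ≤ α * ‖u * f‖ * ‖v * g‖ := hψ _ _ supp_inter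
    _ ≤ α * (‖u‖ * ‖f‖) * (‖v‖ * ‖g‖) := by gcongr <;> exact norm_mul_le _ _
    _ = α * ‖u‖ * ‖v‖ * ‖f‖ * ‖g‖ := by ring

/-- The bilinear map `(f, g) ↦ ψ(f(N ·), g(N ·))`. -/
def dilateForm (N : ℤ) (ψ : FourierAlgebra →L[ℂ] FourierAlgebra →L[ℂ] E) :
    FourierAlgebra →L[ℂ] FourierAlgebra →L[ℂ] E :=
  ψ.bilinearComp (dilate N) (dilate N)

theorem dilateForm_apply (N : ℤ) (f g : FourierAlgebra) :
    dilateForm N ψ f g = ψ (dilate N f) (dilate N g) := rfl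

theorem DisjointBound.dilateForm (hα : 0 ≤ α) (hψ : DisjointBound α ψ) (N : ℤ) :
    DisjointBound α (dilateForm N ψ) := fun f g hfg => by
  have supp_inter : (dilate N f).supp ∩ (dilate N g).supp = ∅ := by
    rw [← Set.subset_empty_iff, ← Set.preimage_empty (f := fun x : Torus => N • x), ← hfg,
      Set.preimage_inter]
    exact Set.inter_subset_inter (supp_dilate_subset N f) (supp_dilate_subset N g)
  calc ‖ψ (dilate N f) (dilate N g)‖ ≤ α * ‖dilate N f‖ * ‖dilate N g‖ := hψ _ _ supp_inter
    _ ≤ α * ‖f‖ * ‖g‖ := by gcongr <;> exact norm_dilate_le N _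

theorem norm_apply_chr_chr_le (ψ : FourierAlgebra →L[ℂ] FourierAlgebra →L[ℂ] E) (m n : ℤ) :
    ‖ψ (chr m) (chr n)‖ ≤ ‖ψ‖ := by
  simpa only [norm_chr, mul_one] using ψ.le_opNorm₂ (chr m) (chr n)

variable [CompleteSpace E]

/-- The map `w ↦ ∑ₙ ŵ(n) ψ(eₙ, e₋ₙ)`, which extends `ψ` to the functions `(x, y) ↦ w(x - y)`. -/
def antidiag (ψ : FourierAlgebra →L[ℂ] FourierAlgebra →L[ℂ] E) : FourierAlgebra →L[ℂ] E :=
  lift (fun n => ψ (chr n) (chr (-n))) fun n => norm_apply_chr_chr_le ψ n (-n)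

theorem antidiag_chr (n : ℤ) : antidiag ψ (chr n) = ψ (chr n) (chr (-n)) := lift_chr _ n

theorem hasSum_antidiag (w : FourierAlgebra) :
    HasSum (fun n => coeff n w • ψ (chr n) (chr (-n))) (antidiag ψ w) := hasSum_lift _ w

theorem antidiag_mulForm_sum_left {ι : Type*} (s : Finset ι) (v : ι → FourierAlgebra)
    (t w : FourierAlgebra) :
    antidiag (mulForm ψ (∑ i ∈ s, v i) t) w = ∑ i ∈ s, antidiag (mulForm ψ (v i) t) w := by
  have : antidiag (mulForm ψ (∑ i ∈ s, v i) t) = ∑ i ∈ s, antidiag (mulForm ψ (v i) t) :=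
    ext_chr fun n => by
      simp only [sum_apply, antidiag_chr, mulForm_apply, Finset.sum_mul,
        map_sum]
  rw [this, sum_apply]

theorem antidiag_mulForm_add_right (v s t w : FourierAlgebra) :
    antidiag (mulForm ψ v (s + t)) w =
      antidiag (mulForm ψ v s) w + antidiag (mulForm ψ v t) w := by
  have : antidiag (mulForm ψ v (s + t)) = antidiag (mulForm ψ v s) + antidiag (mulForm ψ v t) :=
    ext_chr fun n => by
      simp only [add_apply, antidiag_chr, mulForm_apply, add_mul, map_add]
  rw [this, add_apply]

theorem norm_coeff_smul_chr_le (v : FourierAlgebra) (p n : ℤ) :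
    ‖coeff (p - n) v • chr (-n)‖ ≤ ‖v‖ := by
  rw [norm_smul, norm_chr, mul_one]
  exact norm_coeff_le _ v

/-- The map sending `w` to the function `y ↦ ∫ v(x) w(x - y) e^{-ipx} dx / 2π`, the `p`-th Fourier
coefficient of `v(x) w(x - y)` with respect to `x`. -/
def sliceCoeff (v : FourierAlgebra) (p : ℤ) : FourierAlgebra →L[ℂ] FourierAlgebra :=
  lift (fun n => coeff (p - n) v • chr (-n)) (norm_coeff_smul_chr_le v p)

theorem hasSum_sliceCoeff (v w : FourierAlgebra) (p : ℤ) :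
    HasSum (fun n => coeff n w • coeff (p - n) v • chr (-n)) (sliceCoeff v p w) :=
  hasSum_lift _ w

theorem sliceCoeff_apply (v w : FourierAlgebra) (p : ℤ) (y : Torus) :
    sliceCoeff v p w y = coeff p (v * translate y w) := by
  refine ((evalCL y).hasSum (hasSum_sliceCoeff v w p)).unique
    (((coeff p).hasSum ((hasSum_translate y w).mul_left v)).congr_fun fun n => ?_)
  simp only [map_smul, mul_smul_comm, coeff_mul_chr, evalCL_apply, chr_apply, smul_eq_mul]
  ring

theorem summable_coeff_smul_coeff_sub_smul (v t w : FourierAlgebra) :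
    Summable fun q : ℤ × ℤ =>
      coeff q.2 w • coeff (q.1 - q.2) v • ψ (chr q.1) (t * chr (-q.2)) := by
  let shear : ℤ × ℤ ≃ ℤ × ℤ :=
    { toFun q := (q.2, q.1 - q.2)
      invFun q := (q.1 + q.2, q.1)
      left_inv q := by simp
      right_inv q := by simp }
  have hprod : Summable fun q : ℤ × ℤ => ‖coeff q.2 w * coeff (q.1 - q.2) v‖ :=
    shear.summable_iff.2 <|
      Summable.mul_norm (f := fun n => coeff n w) (g := fun n => coeff n v) (summable_coeff w)
        (summable_coeff v)
  refine .of_norm_bounded (hprod.mul_right ‖mulForm ψ 1 t‖) fun q => ?_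
  have hψ := norm_apply_chr_chr_le (mulForm ψ 1 t) q.1 (-q.2)
  rw [mulForm_apply, one_mul] at hψ
  rw [smul_smul, norm_smul]
  gcongr

theorem hasSum_antidiag_mulForm (v t w : FourierAlgebra) :
    HasSum (fun p => ψ (chr p) (t * sliceCoeff v p w)) (antidiag (mulForm ψ v t) w) := by
  have hsum := (summable_coeff_smul_coeff_sub_smul (ψ := ψ) v t w).hasSum
  have by_slices (p : ℤ) :
      HasSum (fun n => coeff n w • coeff (p - n) v • ψ (chr p) (t * chr (-n)))
        (ψ (chr p) (t * sliceCoeff v p w)) := by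
    simpa only [mul_smul_comm, map_smul] using
      (ψ (chr p)).hasSum ((hasSum_sliceCoeff v w p).mul_left t)
  have by_chr (n : ℤ) :
      HasSum (fun p => coeff n w • coeff (p - n) v • ψ (chr p) (t * chr (-n)))
        (coeff n w • mulForm ψ v t (chr n) (chr (-n))) := by
    simpa only [map_smul, coeff_mul_chr, ContinuousLinearMap.flip_apply, mulForm_apply] using
      ((ψ.flip (t * chr (-n))).hasSum (hasSum_chr (v * chr n))).const_smul (coeff n w)
  have sum_eq := ((Equiv.prodComm ℤ ℤ).hasSum_iff.2 hsum).prod_fiberwise by_chr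
  rw [(hasSum_antidiag w).unique sum_eq]
  exact hsum.prod_fiberwise by_slices

theorem antidiag_mulForm_eq_zero {v t w : FourierAlgebra}
    (h : ∀ x y, v x ≠ 0 → t y ≠ 0 → w (x - y) = 0) : antidiag (mulForm ψ v t) w = 0 := by
  have mul_slice_eq_zero (p : ℤ) : t * sliceCoeff v p w = 0 := ext fun y => by
    rw [mul_apply, map_zero, ContinuousMap.zero_apply, mul_eq_zero, or_iff_not_imp_left]
    intro hy
    have hvw : v * translate y w = 0 := ext fun x => by
      rw [mul_apply, translate_apply, map_zero, ContinuousMap.zero_apply, mul_eq_zero,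
        or_iff_not_imp_left]
      exact fun hx => h x y hx hy
    rw [sliceCoeff_apply, hvw, map_zero]
  refine (hasSum_antidiag_mulForm v t w).unique ?_
  simpa only [mul_slice_eq_zero, map_zero] using hasSum_zero

theorem norm_antidiag_mulForm_le (hα : 0 ≤ α) (hψ : DisjointBound α ψ) {v t : FourierAlgebra}
    (hvt : v.supp ∩ t.supp = ∅) (w : FourierAlgebra) :
    ‖antidiag (mulForm ψ v t) w‖ ≤ α * ‖v‖ * ‖t‖ * ‖w‖ := by
  refine norm_le_of_norm_chr_le _ (fun n => ?_) w
  have supp_inter : (chr n * v).supp ∩ (chr (-n) * t).supp = ∅ := Set.subset_empty_iff.1 <|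
    hvt ▸ Set.inter_subset_inter (supp_mul_subset_right _ v) (supp_mul_subset_right _ t)
  rw [antidiag_chr, mulForm_apply, mul_comm v, mul_comm t]
  calc _ ≤ α * ‖chr n * v‖ * ‖chr (-n) * t‖ := hψ _ _ supp_inter
    _ ≤ α * ‖v‖ * ‖t‖ := by gcongr <;> exact norm_chr_mul_le _ _

theorem norm_antidiag_mulForm_one_le (hα : 0 ≤ α) (hψ : DisjointBound α ψ)
    {v t w : FourierAlgebra} (hvt : v.supp ∩ (1 - t).supp = ∅)
    (hw : ∀ x y, v x ≠ 0 → t y ≠ 0 → w (x - y) = 0) :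
    ‖antidiag (mulForm ψ v 1) w‖ ≤ α * ‖v‖ * ‖1 - t‖ * ‖w‖ := by
  have split := antidiag_mulForm_add_right (ψ := ψ) v t (1 - t) w
  rw [add_sub_cancel, antidiag_mulForm_eq_zero hw, zero_add] at split
  rw [split]
  exact norm_antidiag_mulForm_le hα hψ hvt w

end Bilinear

/-! ### Cosine series and piecewise linear functions -/

theorem add_apply (f g : FourierAlgebra) (x : Torus) : (f + g) x = f x + g x := by
  rw [map_add, ContinuousMap.add_apply]

theorem sub_apply (f g : FourierAlgebra) (x : Torus) : (f - g) x = f x - g x := by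
  rw [map_sub, ContinuousMap.sub_apply]

theorem real_smul_apply (c : ℝ) (f : FourierAlgebra) (x : Torus) : (c • f) x = c * f x := by
  rw [← evalCL_apply, ContinuousLinearMap.map_smul_of_tower, evalCL_apply, Complex.real_smul]

theorem norm_real_smul_le {c : ℝ} (hc : 0 ≤ c) {B : ℝ} {f : FourierAlgebra} (hf : ‖f‖ ≤ B) :
    ‖c • f‖ ≤ c * B := by
  rw [norm_smul_of_nonneg hc]
  gcongr

theorem norm_coe_of_abs_le {s : ℝ} (hs : |s| ≤ Real.pi) : ‖(s : Torus)‖ = |s| := by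
  rw [AddCircle.norm_coe_eq_abs_iff _ Real.two_pi_pos.ne', abs_of_pos Real.two_pi_pos]
  linarith

theorem exists_coe_eq_and_abs_le (x : Torus) : ∃ s : ℝ, (s : Torus) = x ∧ |s| ≤ Real.pi := by
  have hx := Set.mem_univ x
  rw [← AddCircle.coe_image_Icc_eq (2 * Real.pi) (-Real.pi)] at hx
  obtain ⟨s, ⟨hle, hge⟩, rfl⟩ := hx
  exact ⟨s, rfl, abs_le.2 ⟨hle, by linarith⟩⟩

/-- `x ↦ cos nx` as an element of `A(𝕋)`. -/
def cosine (n : ℤ) : FourierAlgebra := (1 / 2 : ℝ) • (chr n + chr (-n))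

theorem norm_cosine_le (n : ℤ) : ‖cosine n‖ ≤ 1 := by
  have hchr := norm_add_le (chr n) (chr (-n))
  rw [norm_chr, norm_chr] at hchr
  exact (norm_real_smul_le (by norm_num) hchr).trans_eq (by norm_num)

theorem chr_apply_coe (n : ℤ) (s : ℝ) :
    chr n (s : Torus) = Complex.exp ((n * s : ℝ) * Complex.I) := by
  rw [chr_apply, fourier_coe_apply]
  congr 1
  have : (Real.pi : ℂ) ≠ 0 := mod_cast Real.pi_ne_zero
  push_cast
  field_simp

theorem cosine_apply_coe (n : ℤ) (s : ℝ) : cosine n (s : Torus) = (Real.cos (n * s) : ℝ) := by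
  rw [cosine, real_smul_apply, add_apply, chr_apply_coe, chr_apply_coe, Complex.ofReal_cos,
    Complex.cos]
  push_cast
  ring_nf

theorem dilate_cosine (N n : ℤ) : dilate N (cosine n) = cosine (N * n) := by
  rw [cosine, ContinuousLinearMap.map_smul_of_tower, map_add, dilate_chr, dilate_chr, cosine,
    mul_neg]

theorem translate_cosine_add_translate_neg_cosine (n : ℤ) (h : ℝ) :
    translate (h : Torus) (cosine n) + translate (-(h : Torus)) (cosine n) =
      (2 * Real.cos (n * h)) • cosine n := ext fun x => by
  obtain ⟨s, rfl, -⟩ := exists_coe_eq_and_abs_le x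
  rw [add_apply, translate_apply, translate_apply, sub_neg_eq_add, ← AddCircle.coe_sub,
    ← AddCircle.coe_add, real_smul_apply, cosine_apply_coe, cosine_apply_coe, cosine_apply_coe,
    mul_sub, mul_add, Real.cos_sub, Real.cos_add]
  push_cast
  ring

theorem hasSum_cos_div_sq {s : ℝ} (hs : |s| ≤ 2 * Real.pi) :
    HasSum (fun n : ℕ => 1 / (n : ℝ) ^ 2 * Real.cos (n * s))
      (s ^ 2 / 4 - Real.pi * |s| / 2 + Real.pi ^ 2 / 6) := by
  have := Real.pi_pos
  have hbernoulli := hasSum_one_div_nat_pow_mul_cos one_ne_zero (x := |s| / (2 * Real.pi))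
    ⟨by positivity, div_le_one_of_le₀ hs (by positivity)⟩
  convert hbernoulli using 1
  · funext n
    rw [← Real.cos_abs, abs_mul, Nat.abs_cast]
    congr 2
    field_simp
  · simp only [Polynomial.bernoulli, Finset.sum_range_succ, Polynomial.map_add,
      Polynomial.map_monomial, Polynomial.eval_add, Polynomial.eval_monomial, mul_one,
      Finset.sum_range_zero, zero_add]
    norm_num [bernoulli_one, bernoulli_two, Nat.factorial]
    rw [← sq_abs s]
    field_simp
    ring

/-- The function `∑ₙ cos(nx) / n²`, on `[-2π, 2π]` equal to `x² / 4 - π|x| / 2 + π² / 6`. The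
`n = 0` term of the series is `0`, as `1 / 0 = 0`. -/
def parabola : FourierAlgebra := ∑' n : ℕ, (1 / (n : ℝ) ^ 2) • cosine n

theorem hasSum_parabola : HasSum (fun n : ℕ => (1 / (n : ℝ) ^ 2) • cosine n) parabola :=
  (Summable.of_norm_bounded hasSum_zeta_two.summable fun n =>
    (norm_real_smul_le (by positivity) (norm_cosine_le n)).trans_eq (mul_one _)).hasSum

theorem parabola_apply_coe {s : ℝ} (hs : |s| ≤ 2 * Real.pi) :
    parabola (s : Torus) = (s ^ 2 / 4 - Real.pi * |s| / 2 + Real.pi ^ 2 / 6 : ℝ) := by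
  refine ((evalCL s).hasSum hasSum_parabola).unique
    ((Complex.ofRealCLM.hasSum (hasSum_cos_div_sq hs)).congr_fun fun n => ?_)
  rw [evalCL_apply, real_smul_apply, cosine_apply_coe, Complex.ofRealCLM_apply,
    Complex.ofReal_mul, Int.cast_natCast]

/-- For `0 < h ≤ π`, the hat function `x ↦ max 0 (1 - |x| / h)`, as a second difference of
`parabola`. -/
def hat (h : ℝ) : FourierAlgebra :=
  (h / (2 * Real.pi)) • (1 : FourierAlgebra) + (1 / (Real.pi * h)) •
    ((2 : ℝ) • parabola -
      (translate (h : Torus) parabola + translate (-(h : Torus)) parabola))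

theorem hat_apply_eq_parabola (h : ℝ) (x : Torus) :
    hat h x = h / (2 * Real.pi) +
      1 / (Real.pi * h) * (2 * parabola x - (parabola (x - h) + parabola (x + h))) := by
  rw [hat, add_apply, real_smul_apply, real_smul_apply, sub_apply, add_apply, real_smul_apply,
    translate_apply, translate_apply, sub_neg_eq_add, one_apply]
  push_cast
  rw [mul_one]

theorem abs_sub_add_abs_add (a b : ℝ) : |a - b| + |a + b| = 2 * max |a| |b| := by
  rcases le_total 0 a with ha | ha <;> rcases le_total 0 b with hb | hb <;>
    rcases le_total |a| |b| with hab | hab <;> grind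

theorem hat_apply {h : ℝ} (h_pos : 0 < h) (h_le : h ≤ Real.pi) (x : Torus) :
    hat h x = (max 0 (1 - ‖x‖ / h) : ℝ) := by
  obtain ⟨s, rfl, hs⟩ := exists_coe_eq_and_abs_le x
  have := Real.pi_pos
  have abs_sub_le : |s - h| ≤ 2 * Real.pi := by grind
  have abs_add_le : |s + h| ≤ 2 * Real.pi := by grind
  have sum_abs : |s - h| + |s + h| = 2 * max |s| h := by
    rw [abs_sub_add_abs_add, abs_of_pos h_pos]
  have max_eq : max 0 (1 - |s| / h) = (max |s| h - |s|) / h := by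
    rw [← max_sub_sub_right, sub_self, ← max_div_div_right h_pos.le, zero_div, sub_div,
      div_self h_pos.ne']
  rw [hat_apply_eq_parabola, ← AddCircle.coe_sub, ← AddCircle.coe_add,
    parabola_apply_coe (by linarith), parabola_apply_coe abs_sub_le,
    parabola_apply_coe abs_add_le, norm_coe_of_abs_le hs, max_eq]
  norm_cast
  field_simp
  linear_combination 24 * Real.pi * sum_abs

theorem hat_apply_eq_zero {h : ℝ} (h_pos : 0 < h) (h_le : h ≤ Real.pi) {x : Torus}
    (hx : h ≤ ‖x‖) : hat h x = 0 := by
  rw [hat_apply h_pos h_le, max_eq_left (sub_nonpos.2 ((one_le_div h_pos).2 hx)),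
    Complex.ofReal_zero]

theorem hasSum_hat (h : ℝ) :
    HasSum
      (fun n : ℕ => (2 / (Real.pi * h) * (1 / (n : ℝ) ^ 2 * (1 - Real.cos (n * h)))) • cosine n)
      (hat h - (h / (2 * Real.pi)) • 1) := by
  rw [hat, add_sub_cancel_left]
  refine (((hasSum_parabola.const_smul (2 : ℝ)).sub
    (((translate h).hasSum hasSum_parabola).add
      ((translate (-h)).hasSum hasSum_parabola))).const_smul _).congr_fun fun n => ?_
  rw [ContinuousLinearMap.map_smul_of_tower, ContinuousLinearMap.map_smul_of_tower, ← smul_add,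
    translate_cosine_add_translate_neg_cosine, smul_smul, smul_smul, ← sub_smul, smul_smul,
    Int.cast_natCast]
  congr 1
  ring

theorem norm_hat_le {h : ℝ} (h_pos : 0 < h) (h_le : h ≤ Real.pi) : ‖hat h‖ ≤ 1 := by
  have := Real.pi_pos
  have coeff_nonneg (n : ℕ) :
      0 ≤ 2 / (Real.pi * h) * (1 / (n : ℝ) ^ 2 * (1 - Real.cos (n * h))) := by
    have := sub_nonneg.2 (Real.cos_le_one (n * h))
    positivity
  have hasSum_coeff :
      HasSum (fun n : ℕ => 2 / (Real.pi * h) * (1 / (n : ℝ) ^ 2 * (1 - Real.cos (n * h))))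
        (1 - h / (2 * Real.pi)) := by
    have series := (hasSum_zeta_two.sub (hasSum_cos_div_sq (s := h)
      (by rw [abs_of_pos h_pos]; linarith))).mul_left (2 / (Real.pi * h))
    have value : 2 / (Real.pi * h) * (Real.pi ^ 2 / 6 -
        (h ^ 2 / 4 - Real.pi * |h| / 2 + Real.pi ^ 2 / 6)) = 1 - h / (2 * Real.pi) := by
      rw [abs_of_pos h_pos]
      field_simp
      ring
    rw [value] at series
    exact series.congr_fun fun n => by ring
  have norm_sub_le : ‖hat h - (h / (2 * Real.pi)) • 1‖ ≤ 1 - h / (2 * Real.pi) :=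
    (hasSum_hat h).norm_le_of_bounded hasSum_coeff fun n =>
      (norm_real_smul_le (coeff_nonneg n) (norm_cosine_le n)).trans_eq (mul_one _)
  have norm_const_le : ‖(h / (2 * Real.pi)) • (1 : FourierAlgebra)‖ ≤ h / (2 * Real.pi) * 1 :=
    norm_real_smul_le (by positivity) norm_one.le
  linarith [norm_le_norm_sub_add (hat h) ((h / (2 * Real.pi)) • 1)]

theorem sum_translate_hat {N : ℕ} {h : ℝ} (hN : N * h = 2 * Real.pi) :
    ∑ j ∈ Finset.range N, translate ((j * h : ℝ) : Torus) (hat h) = 1 := ext fun x => by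
  let diff (j : ℕ) : ℂ := parabola (x - (j * h : ℝ)) - parabola (x - (j * h : ℝ) + h)
  have hat_eq (j : ℕ) : translate ((j * h : ℝ) : Torus) (hat h) x =
      h / (2 * Real.pi) + 1 / (Real.pi * h) * (diff j - diff (j + 1)) := by
    have sub_succ : x - ((j + 1 : ℕ) * h : ℝ) = x - (j * h : ℝ) - h := by
      rw [Nat.cast_succ, add_mul, one_mul, AddCircle.coe_add, sub_sub]
    simp only [diff]
    rw [translate_apply, hat_apply_eq_parabola, sub_succ, sub_add_cancel]
    ring
  have diff_periodic : diff N = diff 0 := by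
    simp only [diff, hN, AddCircle.coe_period, Nat.cast_zero, zero_mul, AddCircle.coe_zero]
  have sum_const : (N : ℂ) * (h / (2 * Real.pi)) = 1 := by
    rw [← mul_div_assoc, div_eq_one_iff_eq]
    · exact_mod_cast hN
    · exact_mod_cast Real.two_pi_pos.ne'
  rw [map_sum, ContinuousMap.sum_apply, one_apply]
  simp only [hat_eq]
  rw [Finset.sum_add_distrib, ← Finset.mul_sum, Finset.sum_range_sub', diff_periodic, sub_self,
    mul_zero, add_zero, Finset.sum_const, Finset.card_range, nsmul_eq_mul, sum_const]

/-- For `0 < r < R ≤ π`, the trapezoidal function equal to `1` for `|x| ≤ r`, to `0` for `|x| ≥ R`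
and linear in between. -/
def plateau (r R : ℝ) : FourierAlgebra := (R / (R - r)) • hat R - (r / (R - r)) • hat r

section Plateau

variable {r R : ℝ}

theorem plateau_apply (hr : 0 < r) (hrR : r < R) (hR : R ≤ Real.pi) (x : Torus) :
    plateau r R x = ((max 0 (R - ‖x‖) - max 0 (r - ‖x‖)) / (R - r) : ℝ) := by
  have mul_max {h : ℝ} (hh : 0 < h) : h * max 0 (1 - ‖x‖ / h) = max 0 (h - ‖x‖) := by
    rw [mul_max_of_nonneg _ _ hh.le, mul_zero, mul_one_sub, mul_div_cancel₀ _ hh.ne']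
  rw [plateau, sub_apply, real_smul_apply, real_smul_apply, hat_apply (hr.trans hrR) hR,
    hat_apply hr (hrR.le.trans hR), ← mul_max hr, ← mul_max (hr.trans hrR)]
  push_cast
  ring

theorem plateau_apply_eq_one (hr : 0 < r) (hrR : r < R) (hR : R ≤ Real.pi) {x : Torus}
    (hx : ‖x‖ ≤ r) : plateau r R x = 1 := by
  rw [plateau_apply hr hrR hR, max_eq_right (by linarith), max_eq_right (by linarith),
    sub_sub_sub_cancel_right, div_self (sub_pos.2 hrR).ne', Complex.ofReal_one]

theorem plateau_apply_eq_zero (hr : 0 < r) (hrR : r < R) (hR : R ≤ Real.pi) {x : Torus}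
    (hx : R ≤ ‖x‖) : plateau r R x = 0 := by
  rw [plateau_apply hr hrR hR, max_eq_left (by linarith), max_eq_left (by linarith), sub_self,
    zero_div, Complex.ofReal_zero]

theorem norm_one_sub_translate_plateau_le (hr : 0 < r) (hrR : r < R) (hR : R ≤ Real.pi)
    (c : Torus) : ‖1 - translate c (plateau r R)‖ ≤ 2 * R / (R - r) := by
  have hsub := sub_pos.2 hrR
  have hR_pos := hr.trans hrR
  have norm_hat_R := norm_real_smul_le (c := R / (R - r)) (by positivity) (norm_hat_le hR_pos hR)
  have norm_hat_r := norm_real_smul_le (c := r / (R - r)) (by positivity)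
    (norm_hat_le hr (hrR.le.trans hR))
  calc ‖1 - translate c (plateau r R)‖
      ≤ ‖(1 : FourierAlgebra)‖ + ‖translate c (plateau r R)‖ := norm_sub_le _ _
    _ ≤ 1 + ‖plateau r R‖ := add_le_add norm_one.le (norm_translate_le _ _)
    _ ≤ 1 + (‖(R / (R - r)) • hat R‖ + ‖(r / (R - r)) • hat r‖) := by
      gcongr
      exact norm_sub_le _ _
    _ ≤ 1 + (R / (R - r) * 1 + r / (R - r) * 1) := by gcongr
    _ = 2 * R / (R - r) := by
      field_simp
      ring

theorem supp_subset_of_isClosed {f : FourierAlgebra} {F : Set Torus} (hF : IsClosed F)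
    (hf : ∀ x ∉ F, f x = 0) : f.supp ⊆ F :=
  closure_minimal (fun x hx => by_contra fun hxF => hx (hf x hxF)) hF

theorem supp_translate_hat_subset {h : ℝ} (h_pos : 0 < h) (h_le : h ≤ Real.pi) (c : Torus) :
    (translate c (hat h)).supp ⊆ Metric.closedBall c h :=
  supp_subset_of_isClosed Metric.isClosed_closedBall fun x hx => by
    rw [Metric.mem_closedBall, dist_eq_norm, not_le] at hx
    rw [translate_apply, hat_apply_eq_zero h_pos h_le hx.le]

theorem supp_one_sub_translate_plateau_subset (hr : 0 < r) (hrR : r < R) (hR : R ≤ Real.pi)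
    (c : Torus) : (1 - translate c (plateau r R)).supp ⊆ (Metric.ball c r)ᶜ :=
  supp_subset_of_isClosed Metric.isOpen_ball.isClosed_compl fun x hx => by
    rw [Set.notMem_compl_iff, Metric.mem_ball, dist_eq_norm] at hx
    rw [sub_apply, one_apply, translate_apply, plateau_apply_eq_one hr hrR hR hx.le, sub_self]

end Plateau

section Bilinear

variable {E : Type*} [NormedAddCommGroup E] [NormedSpace ℂ E] [CompleteSpace E]
  {ψ : FourierAlgebra →L[ℂ] FourierAlgebra →L[ℂ] E} {α : ℝ}

theorem norm_antidiag_mulForm_translate_hat_le (hα : 0 ≤ α) (hψ : DisjointBound α ψ) {h r R : ℝ}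
    (h_pos : 0 < h) (hr : h < r) (hrR : r < R) (hR : R ≤ Real.pi) {w : FourierAlgebra}
    (hw : ∀ x : Torus, ‖x‖ ≤ h + R → w x = 0) (c : Torus) :
    ‖antidiag (mulForm ψ (translate c (hat h)) 1) w‖ ≤ α * (2 * R / (R - r)) * ‖w‖ := by
  have r_pos := h_pos.trans hr
  have h_le : h ≤ Real.pi := (hr.trans hrR).le.trans hR
  have supp_inter : (translate c (hat h)).supp ∩ (1 - translate c (plateau r R)).supp = ∅ := by
    refine Set.subset_empty_iff.1 <|
      (Set.inter_subset_inter (supp_translate_hat_subset h_pos h_le c)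
        (supp_one_sub_translate_plateau_subset r_pos hrR hR c)).trans ?_
    rintro x ⟨hxh, hxr⟩
    exact hxr (Metric.closedBall_subset_ball hr hxh)
  have cut_eq_zero (x y : Torus) (hx : translate c (hat h) x ≠ 0)
      (hy : translate c (plateau r R) y ≠ 0) : w (x - y) = 0 := by
    rw [translate_apply] at hx hy
    have hxc := not_le.1 (mt (hat_apply_eq_zero h_pos h_le) hx)
    have hyc := not_le.1 (mt (plateau_apply_eq_zero r_pos hrR hR) hy)
    have norm_sub_le := norm_sub_le (x - c) (y - c)
    rw [sub_sub_sub_cancel_right] at norm_sub_le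
    exact hw _ (by linarith)
  calc _ ≤ α * ‖translate c (hat h)‖ * ‖1 - translate c (plateau r R)‖ * ‖w‖ :=
        norm_antidiag_mulForm_one_le hα hψ supp_inter cut_eq_zero
    _ ≤ α * 1 * (2 * R / (R - r)) * ‖w‖ := by
      gcongr
      · exact (norm_translate_le _ _).trans (norm_hat_le h_pos h_le)
      · exact norm_one_sub_translate_plateau_le r_pos hrR hR c
    _ = α * (2 * R / (R - r)) * ‖w‖ := by rw [mul_one]

theorem norm_antidiag_le_of_eq_zero_near_zero (hα : 0 ≤ α) (hψ : DisjointBound α ψ)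
    {w : FourierAlgebra} (hw : ∀ x : Torus, ‖x‖ ≤ Real.pi / 2 → w x = 0) :
    ‖antidiag ψ w‖ ≤ 96 * α * ‖w‖ := by
  have hπ := Real.pi_pos
  have partition := sum_translate_hat (N := 16) (h := Real.pi / 8) (by push_cast; ring)
  have norm_piece_le (c : Torus) :=
    norm_antidiag_mulForm_translate_hat_le hα hψ (h := Real.pi / 8) (r := Real.pi / 4)
      (R := 3 * Real.pi / 8) (by linarith) (by linarith) (by linarith) (by linarith)
      (fun x hx => hw x (by linarith)) c
  rw [← mulForm_one_one (ψ := ψ)]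
  nth_rw 1 [← partition]
  rw [antidiag_mulForm_sum_left]
  refine (norm_sum_le_of_le _ fun j _ => norm_piece_le _).trans_eq ?_
  rw [Finset.sum_const, Finset.card_range, nsmul_eq_mul]
  push_cast
  field_simp
  ring

end Bilinear

/-! ### The triangle function -/

theorem hasSum_odd {G : Type*} [AddCommGroup G] [TopologicalSpace G] [IsTopologicalAddGroup G]
    {f : ℕ → G} {a b : G} (hf : HasSum f a) (heven : HasSum (fun k => f (2 * k)) b) :
    HasSum (fun k => f (2 * k + 1)) (a - b) := by
  have even_injective : Function.Injective fun k : ℕ => 2 * k := fun k l => by grind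
  have odd_injective : Function.Injective fun k : ℕ => 2 * k + 1 := fun k l => by grind
  have heven' : HasSum (fun n => if Even n then f n else 0) b := by
    refine (even_injective.hasSum_iff fun n hn => if_neg fun ⟨k, hk⟩ => hn ⟨k, ?_⟩).1
      (heven.congr_fun fun k => if_pos (even_two_mul k))
    grind
  refine ((odd_injective.hasSum_iff fun n hn => ?_).2 (hf.sub heven')).congr_fun fun k => ?_
  · rw [if_pos (Nat.not_odd_iff_even.1 fun ⟨k, hk⟩ => hn ⟨k, hk.symm⟩), sub_self]
  · rw [Function.comp_apply, if_neg (Nat.not_even_two_mul_add_one k), sub_zero]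

theorem hasSum_one_div_odd_sq :
    HasSum (fun k : ℕ => 1 / (2 * k + 1 : ℝ) ^ 2) (Real.pi ^ 2 / 8) := by
  have heven := (hasSum_zeta_two.mul_left (1 / 4)).congr_fun
    (g := fun k : ℕ => 1 / ((2 * k : ℕ) : ℝ) ^ 2) fun k => by push_cast; ring
  rw [show Real.pi ^ 2 / 8 = Real.pi ^ 2 / 6 - 1 / 4 * (Real.pi ^ 2 / 6) by ring]
  exact (hasSum_odd hasSum_zeta_two heven).congr_fun fun k => by push_cast; rfl

/-- The function `π|x| / 4` on `[-π, π]`. -/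
def triangle : FourierAlgebra :=
  ((Real.pi ^ 2 / 6) • (1 : FourierAlgebra) - parabola) -
    (1 / 4 : ℝ) • dilate 2 ((Real.pi ^ 2 / 6) • (1 : FourierAlgebra) - parabola)

theorem triangle_apply (x : Torus) : triangle x = (Real.pi * ‖x‖ / 4 : ℝ) := by
  obtain ⟨s, rfl, hs⟩ := exists_coe_eq_and_abs_le x
  have hs2 : |2 • s| ≤ 2 * Real.pi := by
    rw [abs_nsmul, two_nsmul]
    linarith
  rw [triangle, sub_apply, real_smul_apply, dilate_apply, ofNat_zsmul, ← AddCircle.coe_nsmul,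
    sub_apply, sub_apply, real_smul_apply, real_smul_apply, one_apply, one_apply,
    parabola_apply_coe (by linarith [Real.pi_pos]), parabola_apply_coe hs2,
    norm_coe_of_abs_le hs, abs_nsmul, two_nsmul, two_nsmul]
  push_cast
  ring

theorem hasSum_triangle :
    HasSum (fun k : ℕ => (1 / (2 * k + 1 : ℝ) ^ 2) • (1 - cosine (2 * k + 1))) triangle := by
  have hsum : HasSum (fun n : ℕ => (1 / (n : ℝ) ^ 2) • (1 - cosine n))
      ((Real.pi ^ 2 / 6) • (1 : FourierAlgebra) - parabola) := by
    simpa only [smul_sub] using (hasSum_zeta_two.smul_const 1).sub hasSum_parabola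
  have heven := (((dilate 2).hasSum hsum).const_smul (1 / 4 : ℝ)).congr_fun
    (g := fun k : ℕ => (1 / ((2 * k : ℕ) : ℝ) ^ 2) • (1 - cosine (2 * k : ℕ))) fun k => by
      rw [ContinuousLinearMap.map_smul_of_tower, map_sub, dilate_one, dilate_cosine, smul_smul]
      congr 2
      · push_cast
        ring
  exact (hasSum_odd hsum heven).congr_fun fun k => by push_cast; rfl

theorem norm_triangle_le : ‖triangle‖ ≤ Real.pi ^ 2 / 4 := by
  refine (hasSum_triangle.norm_le_of_bounded (hasSum_one_div_odd_sq.mul_right 2)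
    fun k => norm_real_smul_le (by positivity) ?_).trans_eq (by ring)
  calc ‖1 - cosine (2 * k + 1)‖ ≤ ‖(1 : FourierAlgebra)‖ + ‖cosine (2 * k + 1)‖ := norm_sub_le _ _
    _ ≤ 1 + 1 := add_le_add norm_one.le (norm_cosine_le _)
    _ = 2 := one_add_one_eq_two

theorem triangle_sub_dilate_apply {x : Torus} (hx : ‖x‖ ≤ Real.pi / 2) :
    (triangle - (1 / 2 : ℝ) • dilate 2 triangle) x = 0 := by
  obtain ⟨s, rfl, hs⟩ := exists_coe_eq_and_abs_le x
  rw [norm_coe_of_abs_le hs] at hx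
  have hs2 : |2 • s| ≤ Real.pi := by
    rw [abs_nsmul, two_nsmul]
    linarith
  rw [sub_apply, real_smul_apply, dilate_apply, ofNat_zsmul, ← AddCircle.coe_nsmul,
    triangle_apply, triangle_apply, norm_coe_of_abs_le hs, norm_coe_of_abs_le hs2, abs_nsmul,
    two_nsmul]
  push_cast
  ring

theorem norm_triangle_sub_dilate_le :
    ‖triangle - (1 / 2 : ℝ) • dilate 2 triangle‖ ≤ 3 * Real.pi ^ 2 / 8 := by
  have norm_dilate := (norm_dilate_le 2 triangle).trans norm_triangle_le
  calc _ ≤ ‖triangle‖ + ‖(1 / 2 : ℝ) • dilate 2 triangle‖ := norm_sub_le _ _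
    _ ≤ Real.pi ^ 2 / 4 + 1 / 2 * (Real.pi ^ 2 / 4) :=
      add_le_add norm_triangle_le (norm_real_smul_le (by norm_num) norm_dilate)
    _ = 3 * Real.pi ^ 2 / 8 := by ring

theorem chr_one_sub_one :
    chr 1 - 1 = (1 / 2 : ℝ) • dilate 2 (chr 1 - 1) + chr 1 * (1 - cosine 1) := by
  rw [map_sub, dilate_one, dilate_chr, cosine, mul_sub, mul_smul_comm, mul_add, ← chr_add,
    ← chr_add, mul_one, mul_one, add_neg_cancel, chr_zero, one_add_one_eq_two]
  module

section Seminorm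

variable {F : Type*} [AddCommGroup F] [Module ℝ F] {p : Seminorm ℝ F}

theorem seminorm_real_smul {c : ℝ} (hc : 0 ≤ c) (f : F) : p (c • f) = c * p f := by
  rw [map_smul_eq_mul, Real.norm_of_nonneg hc]

theorem seminorm_le_of_hasSum [TopologicalSpace F] (hp : Continuous p) {ι : Type*} {f : ι → F}
    {b : ι → ℝ} {a : F} {B : ℝ} (hf : HasSum f a) (hb : HasSum b B)
    (h : ∀ i, p (f i) ≤ b i) : p a ≤ B :=
  le_of_tendsto_of_tendsto' ((hp.tendsto a).comp hf) hb fun s =>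
    (Finset.le_sum_of_subadditive p (map_zero p).le (map_add_le_add p) s f).trans
      (Finset.sum_le_sum fun i _ => h i)

end Seminorm

section DilationInvariant

variable {p : Seminorm ℝ FourierAlgebra} {K : ℝ}

theorem seminorm_triangle_le (hdilate : ∀ N w, p (dilate N w) ≤ p w)
    (hK : ∀ w : FourierAlgebra, (∀ x : Torus, ‖x‖ ≤ Real.pi / 2 → w x = 0) → p w ≤ K * ‖w‖)
    (hK_nonneg : 0 ≤ K) : p triangle ≤ 3 * Real.pi ^ 2 / 4 * K := by
  have hcut : p (triangle - (1 / 2 : ℝ) • dilate 2 triangle) ≤ K * (3 * Real.pi ^ 2 / 8) :=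
    (hK _ fun _ => triangle_sub_dilate_apply).trans
      (mul_le_mul_of_nonneg_left norm_triangle_sub_dilate_le hK_nonneg)
  have hsplit :=
    map_add_le_add p (triangle - (1 / 2 : ℝ) • dilate 2 triangle) ((1 / 2 : ℝ) • dilate 2 triangle)
  rw [sub_add_cancel, seminorm_real_smul (by norm_num)] at hsplit
  linarith [hdilate 2 triangle]

theorem seminorm_one_sub_cosine_mul_le (hp : Continuous p)
    (hdilate : ∀ N w, p (dilate N w) ≤ p w) :
    (2 - Real.pi ^ 2 / 8) * p (1 - cosine 1) ≤ p triangle := by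
  have htail := (hasSum_nat_add_iff' 1).2 hasSum_triangle
  have hodd := ((hasSum_nat_add_iff' 1).2 hasSum_one_div_odd_sq).mul_right (p (1 - cosine 1))
  have term_le (k : ℕ) : p ((1 / (2 * (k + 1 : ℕ) + 1 : ℝ) ^ 2) •
      (1 - cosine (2 * (k + 1 : ℕ) + 1))) ≤
        1 / (2 * (k + 1 : ℕ) + 1 : ℝ) ^ 2 * p (1 - cosine 1) := by
    have hcos := hdilate (2 * (k + 1 : ℕ) + 1) (1 - cosine 1)
    rw [map_sub, dilate_one, dilate_cosine, mul_one] at hcos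
    rw [seminorm_real_smul (by positivity)]
    gcongr
  have tail_le := seminorm_le_of_hasSum hp htail hodd term_le
  simp only [Finset.range_one, Finset.sum_singleton, Nat.cast_zero, mul_zero, zero_add, one_pow,
    div_one, one_smul] at tail_le
  have hsplit := map_sub_le_add p triangle (triangle - (1 - cosine 1))
  rw [sub_sub_cancel] at hsplit
  linarith

theorem seminorm_chr_one_sub_one_le (hdilate : ∀ N w, p (dilate N w) ≤ p w)
    (hchr : ∀ k w, p (chr k * w) ≤ p w) : p (chr 1 - 1) ≤ 2 * p (1 - cosine 1) := by
  have hsplit := map_add_le_add p ((1 / 2 : ℝ) • dilate 2 (chr 1 - 1)) (chr 1 * (1 - cosine 1))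
  rw [← chr_one_sub_one, seminorm_real_smul (by norm_num)] at hsplit
  linarith [hdilate 2 (chr 1 - 1), hchr 1 (1 - cosine 1)]

theorem pi_sq_div_le :
    12 * Real.pi ^ 2 / (16 - Real.pi ^ 2) ≤ 3 * Real.pi * (1 + Real.sqrt 2) := by
  have hπ := Real.pi_pos
  have hπ_lt := Real.pi_lt_d2
  have sqrt_two_ge : (1.4 : ℝ) ≤ Real.sqrt 2 := Real.le_sqrt_of_sq_le (by norm_num)
  have hpos : 6 ≤ 16 - Real.pi ^ 2 := by nlinarith
  rw [div_le_iff₀ (by linarith)]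
  have : 4 * Real.pi ≤ (1 + Real.sqrt 2) * (16 - Real.pi ^ 2) := by nlinarith
  nlinarith

theorem seminorm_chr_one_sub_one_le_of_eq_zero_near_zero (hp : Continuous p)
    (hdilate : ∀ N w, p (dilate N w) ≤ p w) (hchr : ∀ k w, p (chr k * w) ≤ p w)
    (hK : ∀ w : FourierAlgebra, (∀ x : Torus, ‖x‖ ≤ Real.pi / 2 → w x = 0) → p w ≤ K * ‖w‖)
    (hK_nonneg : 0 ≤ K) : p (chr 1 - 1) ≤ 3 * Real.pi * (1 + Real.sqrt 2) * K := by
  have hpos : 0 < 16 - Real.pi ^ 2 := by nlinarith [Real.pi_pos, Real.pi_lt_four]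
  have hcos := (seminorm_one_sub_cosine_mul_le hp hdilate).trans
    (seminorm_triangle_le hdilate hK hK_nonneg)
  calc p (chr 1 - 1) ≤ 2 * p (1 - cosine 1) := seminorm_chr_one_sub_one_le hdilate hchr
    _ ≤ 12 * Real.pi ^ 2 / (16 - Real.pi ^ 2) * K := by
      rw [div_mul_eq_mul_div, le_div_iff₀ hpos]
      linarith
    _ ≤ 3 * Real.pi * (1 + Real.sqrt 2) * K := by
      gcongr
      exact pi_sq_div_le

end DilationInvariant

/-! ### Twisted and dilated forms -/

section Twist

variable {E : Type*} [NormedAddCommGroup E] [NormedSpace ℂ E]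
  {ψ : FourierAlgebra →L[ℂ] FourierAlgebra →L[ℂ] E} {α : ℝ}

/-- The bilinear map sending the characters `(e_m, e_n)` to `ψ(e_{k + Nm}, e_{l + Nn})`. -/
def twistForm (N k l : ℤ) (ψ : FourierAlgebra →L[ℂ] FourierAlgebra →L[ℂ] E) :
    FourierAlgebra →L[ℂ] FourierAlgebra →L[ℂ] E :=
  dilateForm N (mulForm ψ (chr k) (chr l))

theorem twistForm_chr_chr (N k l m n : ℤ) :
    twistForm N k l ψ (chr m) (chr n) = ψ (chr (k + N * m)) (chr (l + N * n)) := by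
  rw [twistForm, dilateForm_apply, dilate_chr, dilate_chr, mulForm_apply, ← chr_add, ← chr_add]

theorem DisjointBound.twistForm (hα : 0 ≤ α) (hψ : DisjointBound α ψ) (N k l : ℤ) :
    DisjointBound α (twistForm N k l ψ) := by
  have hmul := hψ.mulForm hα (chr k) (chr l)
  rw [norm_chr, norm_chr, mul_one, mul_one] at hmul
  exact hmul.dilateForm hα N

variable [CompleteSpace E]

theorem antidiag_twistForm_chr (N k l n : ℤ) :
    antidiag (twistForm N k l ψ) (chr n) = ψ (chr (k + N * n)) (chr (l - N * n)) := by
  rw [antidiag_chr, twistForm_chr_chr, mul_neg, sub_eq_add_neg]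

theorem norm_antidiag_twistForm_le (N k l : ℤ) (w : FourierAlgebra) :
    ‖antidiag (twistForm N k l ψ) w‖ ≤ ‖ψ‖ * ‖w‖ :=
  norm_le_of_norm_chr_le _ (fun n => by
    rw [antidiag_twistForm_chr]
    exact norm_apply_chr_chr_le ψ _ _) w

theorem antidiag_twistForm_dilate (N k l M : ℤ) (w : FourierAlgebra) :
    antidiag (twistForm N k l ψ) (dilate M w) = antidiag (twistForm (N * M) k l ψ) w := by
  have : (antidiag (twistForm N k l ψ)).comp (dilate M) = antidiag (twistForm (N * M) k l ψ) :=
    ext_chr fun n => by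
      rw [ContinuousLinearMap.comp_apply, dilate_chr, antidiag_twistForm_chr,
        antidiag_twistForm_chr, mul_assoc]
  exact DFunLike.congr_fun this w

theorem antidiag_twistForm_chr_mul (N k l m : ℤ) (w : FourierAlgebra) :
    antidiag (twistForm N k l ψ) (chr m * w) =
      antidiag (twistForm N (k + N * m) (l - N * m) ψ) w := by
  have : (antidiag (twistForm N k l ψ)).comp (ContinuousLinearMap.mul ℂ FourierAlgebra (chr m)) =
      antidiag (twistForm N (k + N * m) (l - N * m) ψ) :=
    ext_chr fun n => by
      rw [ContinuousLinearMap.comp_apply, ContinuousLinearMap.mul_apply', ← chr_add,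
        antidiag_twistForm_chr, antidiag_twistForm_chr, mul_add, add_assoc, sub_sub]
  exact DFunLike.congr_fun this w

/-- The seminorm `w ↦ sup ‖∑ₙ ŵ(n) ψ(e_{k + Nn}, e_{l - Nn})‖`, the supremum being taken over all
integers `N`, `k` and `l`. -/
def antidiagSeminorm (ψ : FourierAlgebra →L[ℂ] FourierAlgebra →L[ℂ] E) :
    Seminorm ℝ FourierAlgebra :=
  ⨆ i : ℤ × ℤ × ℤ, (normSeminorm ℝ E).comp
    ((antidiag (twistForm i.1 i.2.1 i.2.2 ψ)).restrictScalars ℝ).toLinearMap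

theorem bddAbove_range_norm_antidiag_twistForm (w : FourierAlgebra) :
    BddAbove (Set.range fun i : ℤ × ℤ × ℤ => ‖antidiag (twistForm i.1 i.2.1 i.2.2 ψ) w‖) :=
  ⟨‖ψ‖ * ‖w‖, Set.forall_mem_range.2 fun _ => norm_antidiag_twistForm_le _ _ _ w⟩

theorem antidiagSeminorm_apply (w : FourierAlgebra) :
    antidiagSeminorm ψ w = ⨆ i : ℤ × ℤ × ℤ, ‖antidiag (twistForm i.1 i.2.1 i.2.2 ψ) w‖ :=
  Seminorm.iSup_apply (Seminorm.bddAbove_range_iff.2 bddAbove_range_norm_antidiag_twistForm)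

theorem norm_antidiag_twistForm_le_antidiagSeminorm (N k l : ℤ) (w : FourierAlgebra) :
    ‖antidiag (twistForm N k l ψ) w‖ ≤ antidiagSeminorm ψ w := by
  rw [antidiagSeminorm_apply]
  exact le_ciSup (bddAbove_range_norm_antidiag_twistForm w) (N, k, l)

theorem antidiagSeminorm_le {w : FourierAlgebra} {B : ℝ}
    (h : ∀ N k l, ‖antidiag (twistForm N k l ψ) w‖ ≤ B) : antidiagSeminorm ψ w ≤ B := by
  rw [antidiagSeminorm_apply]
  exact ciSup_le fun _ => h _ _ _

theorem continuous_antidiagSeminorm : Continuous (antidiagSeminorm ψ) :=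
  Seminorm.continuous_of_le (q := ‖ψ‖₊ • normSeminorm ℝ FourierAlgebra)
    (continuous_norm.const_smul ‖ψ‖₊)
    fun w => antidiagSeminorm_le fun N k l => norm_antidiag_twistForm_le N k l w

theorem antidiagSeminorm_dilate_le (M : ℤ) (w : FourierAlgebra) :
    antidiagSeminorm ψ (dilate M w) ≤ antidiagSeminorm ψ w :=
  antidiagSeminorm_le fun N k l => by
    rw [antidiag_twistForm_dilate]
    exact norm_antidiag_twistForm_le_antidiagSeminorm _ _ _ w

theorem antidiagSeminorm_chr_mul_le (m : ℤ) (w : FourierAlgebra) :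
    antidiagSeminorm ψ (chr m * w) ≤ antidiagSeminorm ψ w :=
  antidiagSeminorm_le fun N k l => by
    rw [antidiag_twistForm_chr_mul]
    exact norm_antidiag_twistForm_le_antidiagSeminorm _ _ _ w

theorem antidiagSeminorm_chr_one_sub_one_le (hα : 0 ≤ α) (hψ : DisjointBound α ψ) :
    antidiagSeminorm ψ (chr 1 - 1) ≤ 288 * Real.pi * (1 + Real.sqrt 2) * α := by
  have hK (w : FourierAlgebra) (hw : ∀ x : Torus, ‖x‖ ≤ Real.pi / 2 → w x = 0) :
      antidiagSeminorm ψ w ≤ 96 * α * ‖w‖ :=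
    antidiagSeminorm_le fun N k l =>
      norm_antidiag_le_of_eq_zero_near_zero hα (hψ.twistForm hα N k l) hw
  refine (seminorm_chr_one_sub_one_le_of_eq_zero_near_zero continuous_antidiagSeminorm
    antidiagSeminorm_dilate_le antidiagSeminorm_chr_mul_le hK (by positivity)).trans_eq ?_
  ring

theorem norm_apply_chr_sub_le (hα : 0 ≤ α) (hψ : DisjointBound α ψ) (a b c : ℤ) :
    ‖ψ (chr a * chr b) (chr c) - ψ (chr a) (chr b * chr c)‖ ≤
      288 * Real.pi * (1 + Real.sqrt 2) * α := by
  have antidiag_eq : antidiag (twistForm b a (b + c) ψ) (chr 1 - 1) =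
      ψ (chr a * chr b) (chr c) - ψ (chr a) (chr b * chr c) := by
    rw [← chr_zero, map_sub, antidiag_twistForm_chr, antidiag_twistForm_chr, mul_one, mul_zero,
      add_zero, sub_zero, add_sub_cancel_left, chr_add a b, chr_add b c]
  rw [← antidiag_eq]
  exact (norm_antidiag_twistForm_le_antidiagSeminorm b a (b + c) _).trans
    (antidiagSeminorm_chr_one_sub_one_le hα hψ)

end Twist

theorem norm_apply_mul_sub_apply_mul_le {E : Type*} [NormedAddCommGroup E] [NormedSpace ℂ E]
    {ψ : FourierAlgebra →L[ℂ] FourierAlgebra →L[ℂ] E} {C : ℝ}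
    (hψ : ∀ a b c, ‖ψ (chr a * chr b) (chr c) - ψ (chr a) (chr b * chr c)‖ ≤ C)
    (f g h : FourierAlgebra) : ‖ψ (f * g) h - ψ f (g * h)‖ ≤ C * ‖f‖ * ‖g‖ * ‖h‖ := by
  let M := ContinuousLinearMap.mul ℂ FourierAlgebra
  have chr_chr (a b : ℤ) (h : FourierAlgebra) :
      ‖ψ (chr a * chr b) h - ψ (chr a) (chr b * h)‖ ≤ C * ‖h‖ :=
    norm_le_of_norm_chr_le (ψ (chr a * chr b) - (ψ (chr a)).comp (M (chr b))) (hψ a b) h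
  have chr_left (a : ℤ) (g h : FourierAlgebra) :
      ‖ψ (chr a * g) h - ψ (chr a) (g * h)‖ ≤ C * ‖h‖ * ‖g‖ :=
    norm_le_of_norm_chr_le ((ψ.flip h).comp (M (chr a)) - (ψ (chr a)).comp (M.flip h))
      (fun b => chr_chr a b h) g
  exact (norm_le_of_norm_chr_le ((ψ.flip h).comp (M.flip g) - ψ.flip (g * h))
    (fun a => chr_left a g h) f).trans_eq (by ring)

end FourierAlgebra

end

open FourierAlgebra in
theorem mainTheorem1_general {E : Type*} [NormedAddCommGroup E] [NormedSpace ℂ E]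
    {ψ : FourierAlgebra →L[ℂ] FourierAlgebra →L[ℂ] E} {α : ℝ} (hα : 0 ≤ α)
    (hψ : ∀ f g : FourierAlgebra, f.supp ∩ g.supp = ∅ → ‖ψ f g‖ ≤ α * ‖f‖ * ‖g‖)
    (f g h : FourierAlgebra) :
    ‖ψ (f * g) h - ψ f (g * h)‖ ≤
      288 * Real.pi * (1 + Real.sqrt 2) * α * ‖f‖ * ‖g‖ * ‖h‖ := by
  let ι : E →L[ℂ] UniformSpace.Completion E := UniformSpace.Completion.toComplL
  let ψι := (ContinuousLinearMap.compL ℂ FourierAlgebra E _ ι).comp ψ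
  have norm_ι (x : E) : ‖ι x‖ = ‖x‖ := UniformSpace.Completion.norm_coe x
  have hψι : DisjointBound α ψι := fun f g hfg => (norm_ι _).trans_le (hψ f g hfg)
  rw [← norm_ι, map_sub]
  exact norm_apply_mul_sub_apply_mul_le (norm_apply_chr_sub_le hα hψι) f g h

theorem mainTheorem1 :
    (∀ (φ : FourierAlgebra →L[ℂ] FourierAlgebra →L[ℂ] ℂ) (α : ℝ), 0 ≤ α →
      (∀ f g : FourierAlgebra, f.supp ∩ g.supp = ∅ → ‖φ f g‖ ≤ α * ‖f‖ * ‖g‖) →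
      ∀ f g h : FourierAlgebra,
        ‖φ (f * g) h - φ f (g * h)‖
          ≤ 288 * Real.pi * (1 + Real.sqrt 2) * α * ‖f‖ * ‖g‖ * ‖h‖) ∧
    HasStrongPropertyB.{u, 0} FourierAlgebra (288 * Real.pi * (1 + Real.sqrt 2)) :=
  ⟨fun _ _ hα hφ => mainTheorem1_general hα hφ, by positivity, fun _ _ _ _ _ _ hα hφ =>
    mainTheorem1_general hα fun f g hfg =>
      hφ f g (FourierAlgebra.mul_eq_zero_of_supp_inter_eq_empty hfg)⟩
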